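/- Fix a countable vocabulary: reserved distribution functors, arithmetic functors (numerals included) and binary comparison predicates with a fixed meaning over the real numbers (arithmetic functors denote partial functions, comparison predicates denote relations, a distribution functor denotes for each admissible tuple of argument values a probability measure on $\mathbb R$, and each distribution term $\delta$ determines a Borel sample space $\Omega_\delta\subseteq\mathbb R$), together with regular functors and predicates. A *distributional database* $\mathcal D$ is a countable set of facts $\nu\sim\delta_\nu$ with distinct regular ground terms $\nu\in\mathcal V$ (the random variables) and distribution terms $\delta_\nu$; write $\Omega_\nu=\Omega_{\delta_\nu}$. A variable $\mu$ is a parent of $\nu$ if $\mu$ appears in $\delta_\nu$, and "ancestor" is the transitive closure of "parent". $\mathcal D$ is *well-defined* if every variable has finitely many ancestors, the ancestor relation is acyclic, and replacing the parents of $\nu$ in $\delta_\nu$ by arbitrary values from their sample spaces always gives a probability distribution on $\Omega_\nu$, which depends measurably on these values. A *joint law* of $\mathcal D$ is a probability measure $P_{\mathcal V}$ on the value assignments $\omega\in\prod_{\nu\in\mathcal V}\Omega_\nu$ under which each $\nu$, conditionally on its non-descendants, has the distribution $\delta_\nu$ evaluated at the values of its parents. A *comparison atom* over $\mathcal D$ is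 a ground atom $\gamma_1\bowtie\gamma_2$ with a comparison predicate $\bowtie$, where each $\gamma_i$ is a random variable or has an arithmetic functor; it is true under $\omega$ if, after replacing the random variables by their values, both sides evaluate to numbers that are related by $\bowtie$. Let $\mathcal F$ be the set of comparison atoms whose truth set $\{\omega:\kappa\text{ is true under }\omega\}$ is measurable for the completion of the joint law of $\mathcal D$. The *consistent comparisons database* of $\omega$ is $\mathcal F_\omega=\{\kappa\in\mathcal F:\kappa\text{ is true under }\omega\}$. A *DF-PLP program* consists of a well-defined distributional database $\mathcal D$ and a normal logic program $\mathcal R$ whose clause heads are regular atoms and such that the comparison atoms over $\mathcal D$ in the bodies of its ground instances belong to $\mathcal F$; $\mathcal R$ is identified with its grounding over the Herbrand universe. It is *valid* if for every value assignment $\omega$ the ground normal program $\mathcal F_\omega\cup\mathcal R$ has a two-valued well-founded model $M_\omega$. **Proposition.** Let $\mathcal D\cup\mathcal R$ be a valid DF-PLP program. Then: 1. There is exactly one joint law $P_{\mathcal V}$ of $\mathcal D$. 2. There is exactly one probability measure $P_{\mathcal F}$ on the truth value assignments to $\mathcal F$ (the basic distribution) such that for all $\kappa_1,\dots,\kappa_n\in\mathcal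 F$ and $b_1,\dots,b_n\in\{\bot,\top\}$ $$P_{\mathcal F}(\kappa_1=b_1,\dots,\kappa_n=b_n)=P_{\mathcal V}(\{\omega:\ \kappa_i\in\mathcal F_\omega\iff b_i=\top\ \text{ for } i=1,\dots,n\}).$$ 3. For all ground atoms $\mu_1,\dots,\mu_n$ and $b_1,\dots,b_n\in\{\bot,\top\}$ the set $\{\mathcal F_\omega:\ M_\omega\models\mu_1^{b_1}\wedge\dots\wedge\mu_n^{b_n}\}$ is measurable for the completion of $P_{\mathcal F}$ (where $\mu^\top=\mu$ and $\mu^\bot=\neg\mu$), and there is exactly one probability measure $P$ on the Herbrand interpretations, with the product $\sigma$-algebra, such that always $$P(\mu_1=b_1,\dots,\mu_n=b_n)=P_{\mathcal F}(\{\mathcal F_\omega:\ M_\omega\models\mu_1^{b_1}\wedge\dots\wedge\mu_n^{b_n}\}).$$ -/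

import Mathlib

open MeasureTheory

noncomputable section

/-! ### Normal logic programs and the well-founded semantics -/

/-- A literal over a set `A` of atoms: an atom or a negated atom. -/
inductive Literal (A : Type) : Type
  | pos (a : A) : Literal A
  | neg (a : A) : Literal A

namespace Literal

variable {A B : Type}

/-- The atom of a literal. -/
def atom : Literal A → A
  | pos a => a
  | neg a => a

/-- Apply a map to the atom of a literal. -/
def map (f : A → B) : Literal A → Literal B
  | pos a => pos (f a)
  | neg a => neg (f a)

/-- `l` is true in the partial interpretation `I`, where `I.1` is the set of true atoms and `I.2` is
the set of false atoms. -/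
def IsTrue (I : Set A × Set A) : Literal A → Prop
  | pos a => a ∈ I.1
  | neg a => a ∈ I.2

/-- `l` is false in the partial interpretation `I`. -/
def IsFalse (I : Set A × Set A) : Literal A → Prop
  | pos a => a ∈ I.2
  | neg a => a ∈ I.1

theorem IsTrue.mono {I J : Set A × Set A} (h : I ≤ J) {l : Literal A} (hl : l.IsTrue I) :
    l.IsTrue J := by
  cases l with
  | pos a => exact h.1 hl
  | neg a => exact h.2 hl

theorem IsFalse.mono {I J : Set A × Set A} (h : I ≤ J) {l : Literal A} (hl : l.IsFalse I) :
    l.IsFalse J := by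
  cases l with
  | pos a => exact h.2 hl
  | neg a => exact h.1 hl

end Literal

/-- A normal clause `head :- body` over a set `A` of atoms; a fact is a clause with empty body. -/
structure Clause (A : Type) : Type where
  head : A
  body : List (Literal A)

/-- Apply a map to all atoms of a clause. -/
def Clause.map {A B : Type} (f : A → B) (c : Clause A) : Clause B :=
  ⟨f c.head, c.body.map (Literal.map f)⟩

namespace WellFoundedSemantics

variable {A : Type}

/-- Heads of the clauses of the ground program `G` whose bodies are true in `I`. -/
def immediate (G : Set (Clause A)) (I : Set A × Set A) : Set A :=
  {a | ∃ c ∈ G, c.head = a ∧ ∀ l ∈ c.body, l.IsTrue I}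

/-- `U` is an unfounded set of the ground program `G` with respect to `I`: every clause with head in
`U` has a body literal that is false in `I`, or a positive body literal whose atom is in `U`. -/
def IsUnfounded (G : Set (Clause A)) (I : Set A × Set A) (U : Set A) : Prop :=
  ∀ c ∈ G, c.head ∈ U →
    (∃ l ∈ c.body, l.IsFalse I) ∨ ∃ a ∈ U, Literal.pos a ∈ c.body

/-- The greatest unfounded set: the union of all unfounded sets. -/
def greatestUnfounded (G : Set (Clause A)) (I : Set A × Set A) : Set A :=
  ⋃₀ {U | IsUnfounded G I U}

/-- The operator of the well-founded semantics of Van Gelder, Ross and Schlipf. -/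
def operator (G : Set (Clause A)) : (Set A × Set A) →o (Set A × Set A) where
  toFun I := (immediate G I, greatestUnfounded G I)
  monotone' := by
    intro I J hIJ
    refine ⟨?_, ?_⟩
    · rintro a ⟨c, hc, hca, hb⟩
      exact ⟨c, hc, hca, fun l hl => (hb l hl).mono hIJ⟩
    · refine Set.sUnion_subset_sUnion ?_
      intro U hU c hc hcU
      rcases hU c hc hcU with ⟨l, hl, hf⟩ | h
      · exact Or.inl ⟨l, hl, hf.mono hIJ⟩
      · exact Or.inr h

/-- The (partial) well-founded model: the least fixed point of the operator, given by its set of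
true atoms and its set of false atoms. -/
def model (G : Set (Clause A)) : Set A × Set A := OrderHom.lfp (operator G)

/-- The well-founded model is two-valued: the false atoms are exactly those that are not true. -/
def IsTwoValued (G : Set (Clause A)) : Prop := (model G).2 = (model G).1ᶜ

end WellFoundedSemantics

/-! ### Vocabulary, terms and atoms -/

/-- A countable vocabulary. The reserved part consists of the distribution functors, the arithmetic
functors (numerals are arithmetic functors of arity 0) and the binary comparison predicates; the
regular part consists of the other functors and predicates, by arity. -/
structure Vocabulary : Type 1 where
  Dist : ℕ → Type
  Arith : ℕ → Type
  Cmp : Type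
  Fn : ℕ → Type
  Pred : ℕ → Type
  countable_dist : ∀ k, Countable (Dist k)
  countable_arith : ∀ k, Countable (Arith k)
  countable_cmp : Countable Cmp
  countable_fn : ∀ k, Countable (Fn k)
  countable_pred : ∀ k, Countable (Pred k)

namespace Vocabulary

/-- The functors of arity `k`. -/
inductive Functor (S : Vocabulary) (k : ℕ) : Type
  | dist (d : S.Dist k) : Functor S k
  | arith (f : S.Arith k) : Functor S k
  | regular (f : S.Fn k) : Functor S k

/-- The predicates, by arity. -/
inductive Predicate (S : Vocabulary) : ℕ → Type
  | cmp (c : S.Cmp) : Predicate S 2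
  | regular {k : ℕ} (p : S.Pred k) : Predicate S k

/-- The first-order language of the vocabulary. -/
def lang (S : Vocabulary) : FirstOrder.Language.{0, 0} := ⟨S.Functor, S.Predicate⟩

/-- Terms with variables in `X`. -/
abbrev Term (S : Vocabulary) (X : Type) : Type := S.lang.Term X

/-- Ground terms, i.e. elements of the Herbrand universe. -/
abbrev GroundTerm (S : Vocabulary) : Type := S.Term Empty

/-- Apply a functor to terms. -/
def app {S : Vocabulary} {X : Type} {k : ℕ} (f : S.Functor k) (ts : Fin k → S.Term X) : S.Term X :=
  FirstOrder.Language.Term.func (L := S.lang) f ts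

/-- The number `x` as the value of a term; see `Interpretation` below. -/
def num {S : Vocabulary} (x : ℝ) : S.Term ℝ := FirstOrder.Language.Term.var (L := S.lang) x

/-- Atoms with variables in `X`. -/
structure Atom (S : Vocabulary) (X : Type) : Type where
  arity : ℕ
  pred : S.Predicate arity
  args : Fin arity → S.Term X

/-- Ground atoms, i.e. elements of the Herbrand base. A Herbrand interpretation is a set of ground
atoms, namely of those that are true. -/
abbrev GroundAtom (S : Vocabulary) : Type := S.Atom Empty

/-- Apply a substitution to an atom. -/
def Atom.subst {S : Vocabulary} {X Y : Type} (a : S.Atom X) (θ : X → S.Term Y) : S.Atom Y :=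
  ⟨a.arity, a.pred, fun i => (a.args i).subst θ⟩

/-- The ground comparison of two ground terms. -/
def cmpAtom {S : Vocabulary} (c : S.Cmp) (γ₁ γ₂ : S.GroundTerm) : S.GroundAtom :=
  ⟨2, .cmp c, ![γ₁, γ₂]⟩

/-- The predicate of the atom is regular. -/
def Atom.IsRegular {S : Vocabulary} {X : Type} (a : S.Atom X) : Prop :=
  ∃ p : S.Pred a.arity, a.pred = .regular p

/-- The ground term has a regular functor. -/
def IsRegularTerm {S : Vocabulary} (t : S.GroundTerm) : Prop :=
  ∃ (k : ℕ) (f : S.Fn k) (ts : Fin k → S.GroundTerm), t = app (.regular f) ts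

/-- The ground term has an arithmetic functor. -/
def IsArithTerm {S : Vocabulary} (t : S.GroundTerm) : Prop :=
  ∃ (k : ℕ) (f : S.Arith k) (ts : Fin k → S.GroundTerm), t = app (.arith f) ts

/-- `Appears s t`: the ground term `s` occurs in the ground term `t` (possibly `s = t`). -/
inductive Appears {S : Vocabulary} (s : S.GroundTerm) : S.GroundTerm → Prop
  | refl : Appears s s
  | arg {k : ℕ} (f : S.Functor k) (ts : Fin k → S.GroundTerm) (i : Fin k) :
      Appears s (ts i) → Appears s (app f ts)

/-- A normal clause, universally quantified over its variables `0, …, vars - 1`. -/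
structure NormalClause (S : Vocabulary) : Type where
  vars : ℕ
  clause : Clause (S.Atom (Fin vars))

/-- The grounding of a normal logic program with respect to the Herbrand universe. -/
def grounding {S : Vocabulary} (R : Set S.NormalClause) : Set (Clause S.GroundAtom) :=
  {c | ∃ r ∈ R, ∃ θ : Fin r.vars → S.GroundTerm, c = r.clause.map (fun a => a.subst θ)}

/-- The fixed meaning of the reserved vocabulary.

The result of evaluating a ground term, after random variables were replaced by sampled values, is a
term whose variables are real numbers: `num x` is the number `x`, any other value is a symbolic
expression. -/
structure Interpretation (S : Vocabulary) : Type where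
  /-- Arithmetic functors denote partial functions on real numbers. -/
  arith : ∀ {k : ℕ}, S.Arith k → (Fin k → ℝ) → Option ℝ
  /-- Comparison predicates denote binary relations on real numbers. -/
  cmp : S.Cmp → ℝ → ℝ → Prop
  /-- The distribution denoted by a distribution functor for given values of its arguments; `none` if
  there is no distribution with these parameters. -/
  dist : ∀ {k : ℕ}, S.Dist k → (Fin k → S.Term ℝ) → Option (ProbabilityMeasure ℝ)
  /-- The sample space determined by a distribution term. -/
  sampleSpace : ∀ {k : ℕ}, S.Dist k → (Fin k → S.GroundTerm) → Set ℝ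
  measurableSet_sampleSpace : ∀ {k : ℕ} (d : S.Dist k) (ts : Fin k → S.GroundTerm),
    MeasurableSet (sampleSpace d ts)

open Classical in
/-- Apply a functor to evaluated arguments: an arithmetic functor is computed if all arguments are
numbers for which it is defined, and in every other case the expression stays symbolic. -/
def Interpretation.apply {S : Vocabulary} (I : S.Interpretation) {k : ℕ} (f : S.Functor k)
    (vs : Fin k → S.Term ℝ) : S.Term ℝ :=
  match f with
  | .arith φ =>
      if h : ∃ (x : Fin k → ℝ) (y : ℝ), (∀ i, vs i = num (x i)) ∧ I.arith φ x = some y then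
        num h.choose_spec.choose
      else app (.arith φ) vs
  | .dist d => app (.dist d) vs
  | .regular g => app (.regular g) vs

end Vocabulary

/-! ### Distributional databases -/

/-- A distribution term: a ground term whose functor is a distribution functor. -/
structure DistTerm (S : Vocabulary) : Type where
  arity : ℕ
  functor : S.Dist arity
  args : Fin arity → S.GroundTerm

/-- The ground term underlying a distribution term. -/
def DistTerm.toTerm {S : Vocabulary} (δ : DistTerm S) : S.GroundTerm :=
  Vocabulary.app (.dist δ.functor) δ.args

/-- A distributional database: a set of distributional facts `ν ~ dist ν` with distinct regular
ground terms `ν`, the random variables. It is countable since the vocabulary is. -/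
structure DistDB (S : Vocabulary) : Type where
  V : Set S.GroundTerm
  regular : ∀ ν ∈ V, Vocabulary.IsRegularTerm ν
  dist : V → DistTerm S

namespace DistDB

variable {S : Vocabulary}

/-- `μ` is a parent of `ν`. -/
def Parent (D : DistDB S) (μ ν : D.V) : Prop :=
  Vocabulary.Appears (μ : S.GroundTerm) (D.dist ν).toTerm

/-- `μ` is an ancestor of `ν`. -/
def Ancestor (D : DistDB S) (μ ν : D.V) : Prop := Relation.TransGen D.Parent μ ν

/-- The sample space of a random variable. -/
def sampleSpace (D : DistDB S) (I : S.Interpretation) (ν : D.V) : Set ℝ :=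
  I.sampleSpace (D.dist ν).functor (D.dist ν).args

open Classical in
/-- The value of a ground term after replacing each occurrence of a random variable `ν` by `ω ν` and
computing the arithmetic functors. -/
def value (D : DistDB S) (I : S.Interpretation) (ω : D.V → ℝ) : S.GroundTerm → S.Term ℝ
  | .var e => e.elim
  | .func f ts =>
      if h : Vocabulary.app f ts ∈ D.V then Vocabulary.num (ω ⟨_, h⟩)
      else I.apply f (fun i => value D I ω (ts i))

open Classical in
theorem value_app (D : DistDB S) (I : S.Interpretation) (ω : D.V → ℝ) {k : ℕ} (f : S.Functor k)
    (ts : Fin k → S.GroundTerm) :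
    D.value I ω (Vocabulary.app f ts) =
      if h : Vocabulary.app f ts ∈ D.V then Vocabulary.num (ω ⟨_, h⟩)
      else I.apply f (fun i => D.value I ω (ts i)) := rfl

/-- The distribution of `ν` once the random variables in its distribution term are replaced by their
values under `ω`, if there is such a distribution. -/
def dist? (D : DistDB S) (I : S.Interpretation) (ω : D.V → ℝ) (ν : D.V) :
    Option (ProbabilityMeasure ℝ) :=
  I.dist (D.dist ν).functor (fun i => D.value I ω ((D.dist ν).args i))

/-- `dist?` as a measure, with value `0` where there is no distribution. -/
def condLaw (D : DistDB S) (I : S.Interpretation) (ω : D.V → ℝ) (ν : D.V) : Measure ℝ :=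
  match D.dist? I ω ν with
  | some Q => Q
  | none => 0

/-- The values under `ω` of the parents of `ν` belong to their sample spaces. -/
def ParentsSampled (D : DistDB S) (I : S.Interpretation) (ν : D.V) (ω : D.V → ℝ) : Prop :=
  ∀ μ, D.Parent μ ν → ω μ ∈ D.sampleSpace I μ

/-- Well-defined distributional databases. -/
structure IsWellDefined (D : DistDB S) (I : S.Interpretation) : Prop where
  finite_ancestors : ∀ ν, {μ | D.Ancestor μ ν}.Finite
  acyclic : ∀ ν, ¬ D.Ancestor ν ν
  /-- Replacing the parents of `ν` by samples always gives a distribution on the sample space of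
  `ν`. -/
  dist_defined : ∀ ν ω, D.ParentsSampled I ν ω →
    ∃ Q, D.dist? I ω ν = some Q ∧ (Q : Measure ℝ) (D.sampleSpace I ν) = 1
  /-- The distribution of `ν` depends measurably on the values of its parents. -/
  measurable_dist : ∀ ν,
    Measurable (fun ω : {ω : D.V → ℝ // D.ParentsSampled I ν ω} => D.condLaw I ω.1 ν)

/-- Value assignments to all random variables. -/
abbrev Assignment (D : DistDB S) (I : S.Interpretation) : Type :=
  (ν : D.V) → D.sampleSpace I ν

/-- The real numbers assigned to the random variables. -/
def Assignment.val {D : DistDB S} {I : S.Interpretation} (ω : D.Assignment I) : D.V → ℝ :=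
  fun ν => (ω ν : ℝ)

/-- The σ-algebra generated by the random variables other than `ν` of which `ν` is no ancestor. -/
@[reducible] def nonDescendants (D : DistDB S) (I : S.Interpretation) (ν : D.V) :
    MeasurableSpace (D.Assignment I) :=
  ⨆ (μ : D.V) (_ : μ ≠ ν ∧ ¬ D.Ancestor ν μ),
    MeasurableSpace.comap (fun ω : D.Assignment I => ω μ) inferInstance

/-- `PV` is a joint distribution of the random variables, viewed as the nodes of a Bayesian network:
conditionally on its non-descendants, each `ν` has the distribution obtained from its distribution
term by plugging in the values of its parents. -/
structure IsJointLaw (D : DistDB S) (I : S.Interpretation) (PV : Measure (D.Assignment I)) :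
    Prop where
  isProbabilityMeasure : IsProbabilityMeasure PV
  law : ∀ (ν : D.V) (E : Set (D.Assignment I)) (B : Set ℝ),
    MeasurableSet[D.nonDescendants I ν] E → MeasurableSet B →
      PV (E ∩ {ω | ω.val ν ∈ B}) = ∫⁻ ω in E, D.condLaw I ω.val ν B ∂PV

/-- `κ` is a comparison atom over `D`: each side is a random variable or has an arithmetic functor. -/
def IsComparison (D : DistDB S) (κ : S.GroundAtom) : Prop :=
  ∃ c γ₁ γ₂, κ = Vocabulary.cmpAtom c γ₁ γ₂ ∧
    (γ₁ ∈ D.V ∨ Vocabulary.IsArithTerm γ₁) ∧ (γ₂ ∈ D.V ∨ Vocabulary.IsArithTerm γ₂)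

/-- The comparison `κ` is true after setting all random variables to their values under `ω`. -/
def Holds (D : DistDB S) (I : S.Interpretation) (ω : D.V → ℝ) (κ : S.GroundAtom) : Prop :=
  ∃ c γ₁ γ₂ x y, κ = Vocabulary.cmpAtom c γ₁ γ₂ ∧
    D.value I ω γ₁ = Vocabulary.num x ∧ D.value I ω γ₂ = Vocabulary.num y ∧ I.cmp c x y

/-- The measurable Boolean comparison atoms over `D`: the set of value assignments that make the atom
true is measurable for the completion of the joint distribution of the random variables (which exists
and is unique if `D` is well-defined); in particular it may be any Borel set. -/
def comparisons (D : DistDB S) (I : S.Interpretation) : Set S.GroundAtom :=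
  {κ | D.IsComparison κ ∧
    ∀ PV, D.IsJointLaw I PV → NullMeasurableSet {ω : D.Assignment I | D.Holds I ω.val κ} PV}

/-- The consistent comparisons database of a value assignment, as a set of measurable comparison
atoms. -/
def ccd (D : DistDB S) (I : S.Interpretation) (ω : D.Assignment I) : Set (D.comparisons I) :=
  {κ | D.Holds I ω.val κ}

end DistDB

/-! ### DF-PLP programs -/

/-- A DF-PLP program. Clause heads are regular atoms. A comparison atom over the database in the body
of a ground instance of a clause has to be measurable. -/
structure DFProgram {S : Vocabulary} (I : S.Interpretation) : Type where
  db : DistDB S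
  wellDefined : db.IsWellDefined I
  rules : Set S.NormalClause
  head_regular : ∀ r ∈ rules, r.clause.head.IsRegular
  body_measurable : ∀ c ∈ Vocabulary.grounding rules, ∀ l ∈ c.body,
    db.IsComparison l.atom → l.atom ∈ db.comparisons I

namespace DFProgram

variable {S : Vocabulary} {I : S.Interpretation}

/-- The ground normal logic program consisting of the rules and of the comparison atoms in `J` as
facts. -/
def logicProgram (P : DFProgram I) (J : Set (P.db.comparisons I)) : Set (Clause S.GroundAtom) :=
  {c | ∃ κ ∈ J, c = ⟨κ, []⟩} ∪ Vocabulary.grounding P.rules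

/-- The true atoms of the well-founded model of the rules together with the facts `J`. -/
def wfm (P : DFProgram I) (J : Set (P.db.comparisons I)) : Set S.GroundAtom :=
  (WellFoundedSemantics.model (P.logicProgram J)).1

/-- Validity: the well-founded model is two-valued for each consistent comparisons database. -/
def Valid (P : DFProgram I) : Prop :=
  ∀ ω : P.db.Assignment I, WellFoundedSemantics.IsTwoValued (P.logicProgram (P.db.ccd I ω))

/-- `PF` is the basic distribution: the probability measure on truth value assignments to the
comparison atoms with the finite-dimensional marginals that `PV` induces. -/
structure IsBasicDistribution (P : DFProgram I) (PV : Measure (P.db.Assignment I))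
    (PF : Measure (Set (P.db.comparisons I))) : Prop where
  isProbabilityMeasure : IsProbabilityMeasure PF
  marginal : ∀ (s : Finset (P.db.comparisons I)) (b : P.db.comparisons I → Prop),
    PF {J | ∀ κ ∈ s, (κ ∈ J ↔ b κ)} = PV {ω | ∀ κ ∈ s, (κ ∈ P.db.ccd I ω ↔ b κ)}

/-- The consistent comparisons databases whose well-founded model gives the truth values `b` to the
atoms in `s`. -/
def ccdEvent (P : DFProgram I) (s : Finset S.GroundAtom) (b : S.GroundAtom → Prop) :
    Set (Set (P.db.comparisons I)) :=
  {J | (∃ ω, J = P.db.ccd I ω) ∧ ∀ μ ∈ s, (μ ∈ P.wfm J ↔ b μ)}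

/-- `PP` is the extension of the basic distribution `PF` to Herbrand interpretations by Sato's
construction: the probability of a truth value assignment to finitely many ground atoms is the
probability (which has to make sense) of the consistent comparisons databases whose well-founded model
satisfies it. -/
structure IsSatoExtension (P : DFProgram I) (PF : Measure (Set (P.db.comparisons I)))
    (PP : Measure (Set S.GroundAtom)) : Prop where
  isProbabilityMeasure : IsProbabilityMeasure PP
  nullMeasurableSet_ccdEvent : ∀ (s : Finset S.GroundAtom) (b : S.GroundAtom → Prop),
    NullMeasurableSet (P.ccdEvent s b) PF
  marginal : ∀ (s : Finset S.GroundAtom) (b : S.GroundAtom → Prop),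
    PP {M | ∀ μ ∈ s, (μ ∈ M ↔ b μ)} = PF (P.ccdEvent s b)

end DFProgram

end

/-! Joint law. Finitely many ancestors and acyclicity make the parent relation well-founded. For
existence (`isJointLaw_map_sample`), every variable receives independent uniform noise and values
are computed along the parent relation; the noise of `ν` is independent of its non-descendants,
which yields the required conditional law. For uniqueness (`IsJointLaw.eq`), the law on a finite
parent-closed set of variables is determined by induction on the set, and the events depending on
such sets generate the product σ-algebra.

The basic distribution is the image of the joint law under `ccd`, which is almost everywhere
measurable because there are only countably many atoms, each with a null measurable truth set.

Its extension is the image under `wfm`. The difficulty is measurability: the well-founded model is a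
least fixed point that may need transfinitely many steps, and validity controls it only on the range
of `ccd`. However, a two-valued well-founded model is the only stable model
(`IsTwoValued.isStable_iff`), and stability is a Borel condition, since least models of reducts are
reached after ω steps. Hence the model has a Borel graph, and Lusin–Souslin applies
(`measurableSet_mem_model`) on a Borel subset of the range that carries the whole mass
(`exists_measurableSet_subset_range`). -/

noncomputable section

/-! ### Two-valued well-founded models and stable models -/

namespace WellFoundedSemantics

variable {A : Type}

/-- The atoms derivable in at most `n` steps from the reduct of the ground program `G` with respect
to the interpretation `M`. -/
def reductStage (G : Set (Clause A)) (M : Set A) : ℕ → Set A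
  | 0 => ∅
  | n + 1 => immediate G (reductStage G M n, Mᶜ)

/-- The least model of the reduct of `G` with respect to `M`. -/
def reductModel (G : Set (Clause A)) (M : Set A) : Set A := ⋃ n, reductStage G M n

/-- `M` is a stable model of `G`. -/
def IsStable (G : Set (Clause A)) (M : Set A) : Prop := reductModel G M = M

theorem immediate_mono (G : Set (Clause A)) {I J : Set A × Set A} (h : I ≤ J) :
    immediate G I ⊆ immediate G J :=
  ((operator G).monotone h).1

theorem reductStage_mono (G : Set (Clause A)) (M : Set A) : Monotone (reductStage G M) := by
  refine monotone_nat_of_le_succ fun n => ?_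
  induction n with
  | zero => exact Set.empty_subset _
  | succ n ih => exact immediate_mono G ⟨ih, le_rfl⟩

theorem reductStage_subset_reductModel (G : Set (Clause A)) (M : Set A) (n : ℕ) :
    reductStage G M n ⊆ reductModel G M :=
  Set.subset_iUnion _ n

/-- Bodies are finite and the stages increase, so one stage serves a whole body. This is why ω steps
suffice. -/
theorem exists_reductStage_of_isTrue (G : Set (Clause A)) (M : Set A) (b : List (Literal A))
    (hb : ∀ l ∈ b, l.IsTrue (reductModel G M, Mᶜ)) :
    ∃ n, ∀ l ∈ b, l.IsTrue (reductStage G M n, Mᶜ) := by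
  induction b with
  | nil => exact ⟨0, by simp⟩
  | cons l b ih =>
    obtain ⟨n, hn⟩ := ih fun l' hl' => hb l' (List.mem_cons_of_mem _ hl')
    obtain ⟨m, hm⟩ : ∃ m, l.IsTrue (reductStage G M m, Mᶜ) := by
      have h := hb l List.mem_cons_self
      cases l with
      | pos a => exact Set.mem_iUnion.1 h
      | neg a => exact ⟨0, h⟩
    refine ⟨max n m, fun l' hl' => ?_⟩
    rcases List.mem_cons.1 hl' with rfl | h
    · exact hm.mono (Prod.mk_le_mk.2 ⟨reductStage_mono G M (le_max_right _ _), le_rfl⟩)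
    · exact (hn l' h).mono (Prod.mk_le_mk.2 ⟨reductStage_mono G M (le_max_left _ _), le_rfl⟩)

theorem immediate_reductModel_subset (G : Set (Clause A)) (M : Set A) :
    immediate G (reductModel G M, Mᶜ) ⊆ reductModel G M := by
  rintro a ⟨c, hc, hca, hb⟩
  obtain ⟨n, hn⟩ := exists_reductStage_of_isTrue G M c.body hb
  exact reductStage_subset_reductModel G M (n + 1) ⟨c, hc, hca, hn⟩

theorem reductModel_subset_of_immediate_subset {G : Set (Clause A)} {M N : Set A}
    (h : immediate G (N, Mᶜ) ⊆ N) : reductModel G M ⊆ N := by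
  refine Set.iUnion_subset fun n => ?_
  induction n with
  | zero => exact Set.empty_subset _
  | succ n ih => exact (immediate_mono G (Prod.mk_le_mk.2 ⟨ih, le_rfl⟩)).trans h

/-- The well-founded model is contained in every stable model. -/
theorem IsStable.model_le {G : Set (Clause A)} {M : Set A} (h : IsStable G M) :
    model G ≤ (M, Mᶜ) := by
  refine OrderHom.lfp_le _ ⟨?_, ?_⟩
  · have := immediate_reductModel_subset G M
    rwa [show reductModel G M = M from h] at this
  · refine Set.sUnion_subset fun U hU => ?_
    -- No derivation can enter an unfounded set: a clause deriving an atom of `U` would need an atom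
    -- of `U` derived at an earlier stage.
    have key : ∀ n, ∀ a ∈ reductStage G M n, a ∉ U := by
      intro n
      induction n with
      | zero => exact fun a ha => absurd ha (Set.notMem_empty a)
      | succ n ih =>
        rintro a ⟨c, hc, rfl, hb⟩ haU
        rcases hU c hc haU with ⟨l, hl, hf⟩ | ⟨a, ha, hl⟩
        · have ht := hb l hl
          cases l with
          | pos a => exact hf (h.subset (reductStage_subset_reductModel G M n ht))
          | neg a => exact ht hf
        · exact ih a (hb _ hl) ha
    intro a haU haM
    obtain ⟨n, hn⟩ := Set.mem_iUnion.1 (h.symm.subset haM)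
    exact key n a hn haU

theorem immediate_model (G : Set (Clause A)) : immediate G (model G) = (model G).1 :=
  congrArg Prod.fst (operator G).map_lfp

theorem greatestUnfounded_model (G : Set (Clause A)) :
    greatestUnfounded G (model G) = (model G).2 :=
  congrArg Prod.snd (operator G).map_lfp

theorem IsTwoValued.model_eq {G : Set (Clause A)} (h : IsTwoValued G) :
    model G = ((model G).1, (model G).1ᶜ) :=
  Prod.ext rfl h

/-- A two-valued well-founded model is stable. -/
theorem IsTwoValued.isStable {G : Set (Clause A)} (h : IsTwoValued G) :
    IsStable G (model G).1 := by
  refine Set.Subset.antisymm ?_ ?_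
  · refine reductModel_subset_of_immediate_subset ?_
    rw [← h.model_eq, immediate_model]
  -- The underivable atoms are unfounded: a clause violating this would have a body true in the
  -- reduct, and its head would be derived.
  · have hU : IsUnfounded G (model G) (reductModel G (model G).1)ᶜ := by
      intro c hc hcU
      by_contra! hcon
      refine hcU (immediate_reductModel_subset G _ ⟨c, hc, rfl, fun l hl => ?_⟩)
      cases l with
      | pos a => exact not_not.1 fun ha => hcon.2 a ha hl
      | neg a => exact fun ha => hcon.1 _ hl ha
    have hsub := (Set.subset_sUnion_of_mem hU).trans (greatestUnfounded_model G).subset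
    rw [show (model G).2 = (model G).1ᶜ from h] at hsub
    exact Set.compl_subset_compl.1 hsub

/-- A two-valued well-founded model is the unique stable model. -/
theorem IsTwoValued.isStable_iff {G : Set (Clause A)} (h : IsTwoValued G) {M : Set A} :
    IsStable G M ↔ M = (model G).1 := by
  refine ⟨fun hM => ?_, fun hM => hM ▸ h.isStable⟩
  have hle := hM.model_le
  rw [h.model_eq] at hle
  exact Set.Subset.antisymm (Set.compl_subset_compl.1 hle.2) hle.1

end WellFoundedSemantics

/-! ### Measurable dependence of the model on the program -/

instance Literal.countable {A : Type} [Countable A] : Countable (Literal A) := by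
  refine Function.Surjective.countable
    (f := fun x : A ⊕ A => x.elim Literal.pos Literal.neg) fun l => ?_
  cases l with
  | pos a => exact ⟨.inl a, rfl⟩
  | neg a => exact ⟨.inr a, rfl⟩

instance Clause.countable {A : Type} [Countable A] : Countable (Clause A) :=
  Function.Surjective.countable (f := fun x : A × List (Literal A) => Clause.mk x.1 x.2)
    fun c => ⟨(c.head, c.body), rfl⟩

instance Set.standardBorelSpace {A : Type} [Countable A] : StandardBorelSpace (Set A) :=
  inferInstanceAs (StandardBorelSpace (A → Prop))

namespace WellFoundedSemantics

variable {A Ω : Type} [Countable A] [MeasurableSpace Ω]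

theorem measurable_reductStage {G : Ω → Set (Clause A)} {M : Ω → Set A} (hG : Measurable G)
    (hM : Measurable M) (n : ℕ) : Measurable fun x => reductStage (G x) (M x) n := by
  induction n with
  | zero => exact measurable_const
  | succ n ih =>
    refine measurable_set_iff.2 fun a => ?_
    refine Measurable.exists fun c => ((measurable_set_iff.1 hG c).and (measurable_const.and ?_))
    refine Measurable.forall fun l => Measurable.imp measurable_const ?_
    cases l with
    | pos b => exact measurable_set_iff.1 ih b
    | neg b => exact (measurable_set_iff.1 hM b).not

theorem measurable_reductModel {G : Ω → Set (Clause A)} {M : Ω → Set A} (hG : Measurable G)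
    (hM : Measurable M) : Measurable fun x => reductModel (G x) (M x) := by
  refine measurable_set_iff.2 fun a => ?_
  simp only [reductModel, Set.mem_iUnion]
  exact Measurable.exists fun n => measurable_set_iff.1 (measurable_reductStage hG hM n) a

theorem measurableSet_isStable {G : Ω → Set (Clause A)} {M : Ω → Set A} (hG : Measurable G)
    (hM : Measurable M) : MeasurableSet {x | IsStable (G x) (M x)} :=
  measurableSet_eq_fun (measurable_reductModel hG hM) hM

/-- The well-founded model depends measurably on the program wherever it is two-valued. -/
theorem measurableSet_mem_model [StandardBorelSpace Ω] {G : Ω → Set (Clause A)}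
    (hG : Measurable G) {K : Set Ω} (hK : MeasurableSet K) (h : ∀ x ∈ K, IsTwoValued (G x))
    (a : A) : MeasurableSet (K ∩ {x | a ∈ (model (G x)).1}) := by
  -- The pairs of a program parameter and a stable model form a Borel set. By uniqueness the
  -- projection is injective on it, so its image is Borel by Lusin–Souslin.
  have hT : MeasurableSet {p : Ω × Set A | p.1 ∈ K ∧ IsStable (G p.1) p.2 ∧ a ∈ p.2} :=
    (measurable_fst hK).inter
      ((measurableSet_isStable (hG.comp measurable_fst) measurable_snd).inter
        (measurable_snd (measurableSet_mem a)))
  have hinj : Set.InjOn Prod.fst {p : Ω × Set A | p.1 ∈ K ∧ IsStable (G p.1) p.2 ∧ a ∈ p.2} := by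
    rintro ⟨x, M⟩ ⟨hx, hM, -⟩ ⟨y, N⟩ ⟨-, hN, -⟩ rfl
    exact Prod.ext rfl ((((h x hx).isStable_iff).1 hM).trans (((h x hx).isStable_iff).1 hN).symm)
  convert! hT.image_of_measurable_injOn measurable_fst hinj using 1
  ext x
  constructor
  · rintro ⟨hx, hxa⟩
    exact ⟨(x, (model (G x)).1), ⟨hx, (h x hx).isStable, hxa⟩, rfl⟩
  · rintro ⟨⟨x, M⟩, ⟨hx, hM, ha⟩, rfl⟩
    exact ⟨hx, (((h x hx).isStable_iff).1 hM).subset ha⟩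

end WellFoundedSemantics

/-! ### Measurable sets of full measure inside a range -/

namespace MeasureTheory

/-- The range of an almost everywhere measurable map between standard Borel spaces contains a
measurable set of full measure. -/
theorem exists_measurableSet_subset_range {X Y : Type*} [MeasurableSpace X] [StandardBorelSpace X]
    [MeasurableSpace Y] [StandardBorelSpace Y] {μ : Measure X} [IsFiniteMeasure μ] {f : X → Y}
    (hf : AEMeasurable f μ) :
    ∃ K ⊆ Set.range f, MeasurableSet K ∧ μ.map f Kᶜ = 0 := by
  let τX := upgradeStandardBorel X
  let τY := upgradeStandardBorel Y
  -- A finer Polish topology makes the measurable representative continuous without changing the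
  -- Borel sets, so inner regularity by compact sets remains available.
  obtain ⟨t, ht, hcont, hpol⟩ := hf.measurable_mk.exists_continuous
  have hborel : @BorelSpace X t _ := by
    refine @BorelSpace.mk X t _ ?_
    rw [borel_eq_borel_of_le (t' := τX.toTopologicalSpace) hpol inferInstance ht]
    exact BorelSpace.measurable_eq
  obtain ⟨N, hN, hNm, hN0⟩ : ∃ N, {x | ¬ f x = hf.mk f x} ⊆ N ∧ MeasurableSet N ∧ μ N = 0 :=
    exists_measurable_superset_of_null (ae_iff.1 hf.ae_eq_mk)
  -- The compact sets avoid `N`, so `f` agrees there with its representative and their images lie in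
  -- the range of `f`; being compact, these images are measurable.
  have hcomp : ∀ n : ℕ, ∃ C ⊆ Nᶜ, @IsCompact X t C ∧
      μ Nᶜ < μ C + (n : ENNReal)⁻¹ := fun n => by
    let := t
    exact hNm.compl.exists_isCompact_lt_add (measure_ne_top _ _) (by simp)
  choose C hCN hC hlt using hcomp
  have hCm : ∀ n, MeasurableSet (C n) := fun n => by
    let := t
    exact (hC n).measurableSet
  have hKm : ∀ n, MeasurableSet (hf.mk f '' C n) := fun n => by
    have : IsCompact (hf.mk f '' C n) := by
      refine @IsCompact.image X Y t _ _ _ (hC n) hcont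
    exact this.measurableSet
  refine ⟨⋃ n, hf.mk f '' C n, ?_, MeasurableSet.iUnion hKm, ?_⟩
  · refine Set.iUnion_subset fun n => ?_
    rintro _ ⟨x, hx, rfl⟩
    exact ⟨x, not_not.1 fun hne => hCN n hx (hN hne)⟩
  · rw [Measure.map_congr hf.ae_eq_mk, Measure.map_apply hf.measurable_mk
      (MeasurableSet.iUnion hKm).compl]
    refine le_antisymm (ge_of_tendsto' ENNReal.tendsto_inv_nat_nhds_zero fun n => ?_) bot_le
    have hsub : hf.mk f ⁻¹' (⋃ n, hf.mk f '' C n)ᶜ ⊆ N ∪ (Nᶜ \ C n) := by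
      intro x hx
      by_cases hxN : x ∈ N
      · exact Or.inl hxN
      · exact Or.inr ⟨hxN, fun hxC => hx (Set.mem_iUnion.2 ⟨n, x, hxC, rfl⟩)⟩
    refine (measure_mono hsub).trans ((measure_union_le _ _).trans ?_)
    rw [hN0, zero_add, measure_sdiff (hCN n) (hCm n).nullMeasurableSet (measure_ne_top _ _)]
    exact tsub_le_iff_left.2 (hlt n).le

end MeasureTheory

/-! ### Countability of the Herbrand base -/

namespace Vocabulary

variable {S : Vocabulary}

instance countable_functor (k : ℕ) : Countable (S.Functor k) := by
  have := S.countable_dist k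
  have := S.countable_arith k
  have := S.countable_fn k
  refine Function.Surjective.countable (f := fun x : S.Dist k ⊕ S.Arith k ⊕ S.Fn k =>
    x.elim Functor.dist (Sum.elim Functor.arith Functor.regular)) fun f => ?_
  cases f with
  | dist d => exact ⟨.inl d, rfl⟩
  | arith d => exact ⟨.inr (.inl d), rfl⟩
  | regular d => exact ⟨.inr (.inr d), rfl⟩

instance countable_predicate (k : ℕ) : Countable (S.Predicate k) := by
  have := S.countable_cmp
  have := S.countable_pred
  -- Comparison predicates exist only at arity 2, so all arities are counted together and each one
  -- is then embedded in the sum.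
  have hs : Function.Surjective (fun x : S.Cmp ⊕ (Σ k, S.Pred k) =>
      (x.elim (fun c => ⟨2, .cmp c⟩) fun p => ⟨p.1, .regular p.2⟩ : Σ k, S.Predicate k)) := by
    rintro ⟨k, p⟩
    cases p with
    | cmp c => exact ⟨.inl c, rfl⟩
    | regular p => exact ⟨.inr ⟨k, p⟩, rfl⟩
  have := hs.countable
  exact (sigma_mk_injective (β := S.Predicate) (i := k)).countable

instance countable_groundTerm : Countable S.GroundTerm := by
  have (k : ℕ) : Countable (S.lang.Functions k) := countable_functor k
  exact inferInstanceAs (Countable (S.lang.Term Empty))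

instance countable_groundAtom : Countable S.GroundAtom :=
  Function.Surjective.countable
    (f := fun x : Σ k, S.Predicate k × (Fin k → S.GroundTerm) => Atom.mk x.1 x.2.1 x.2.2)
    fun a => ⟨⟨a.arity, a.pred, a.args⟩, rfl⟩

end Vocabulary

/-! ### Measures on, and random elements of, a power set -/

namespace MeasureTheory

variable {A : Type*}

theorem measurableSet_truthValues (s : Finset A) (b : A → Prop) :
    MeasurableSet {J : Set A | ∀ a ∈ s, (a ∈ J ↔ b a)} := by
  have : {J : Set A | ∀ a ∈ s, (a ∈ J ↔ b a)} = ⋂ a ∈ s, {J | a ∈ J ↔ b a} := by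
    ext J; simp
  rw [this]
  exact s.measurableSet_biInter fun a _ =>
    measurableSet_setOfPred.2 ((measurable_set_mem a).iff measurable_const)

/-- A finite measure on the subsets of a type is determined by the probabilities of the truth value
assignments to finitely many elements. -/
theorem Measure.ext_of_truthValues {μ ν : Measure (Set A)} [IsFiniteMeasure μ]
    (h : ∀ (s : Finset A) (b : A → Prop),
      μ {J | ∀ a ∈ s, (a ∈ J ↔ b a)} = ν {J | ∀ a ∈ s, (a ∈ J ↔ b a)}) : μ = ν := by
  classical
  refine ext_of_generate_finite
    {E | ∃ (s : Finset A) (b : A → Prop), E = {J | ∀ a ∈ s, (a ∈ J ↔ b a)}} ?_ ?_ ?_ ?_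
  · refine le_antisymm ?_ (MeasurableSpace.generateFrom_le ?_)
    · refine iSup_le fun a => Measurable.comap_le ?_
      refine (@measurableSet_setOfPred (Set A) (.generateFrom _) (a ∈ ·)).1
        (MeasurableSpace.measurableSet_generateFrom ⟨{a}, fun _ => True, ?_⟩)
      ext J; simp
    · rintro _ ⟨s, b, rfl⟩
      exact measurableSet_truthValues s b
  · rintro _ ⟨s, b, rfl⟩ _ ⟨s', b', rfl⟩ ⟨J, hJ, hJ'⟩
    -- Any point `J` of the intersection supplies consistent truth values on `s ∪ s'`.
    refine ⟨s ∪ s', (· ∈ J), Set.ext fun K => ?_⟩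
    constructor
    · rintro ⟨hK, hK'⟩ a ha
      rcases Finset.mem_union.1 ha with ha | ha
      · exact (hK a ha).trans (hJ a ha).symm
      · exact (hK' a ha).trans (hJ' a ha).symm
    · intro hK
      exact ⟨fun a ha => (hK a (Finset.mem_union_left _ ha)).trans (hJ a ha),
        fun a ha => (hK a (Finset.mem_union_right _ ha)).trans (hJ' a ha)⟩
  · rintro _ ⟨s, b, rfl⟩
    exact h s b
  · simpa using h ∅ fun _ => True

theorem aemeasurable_set_of_nullMeasurableSet {X : Type*} [MeasurableSpace X] [Countable A]
    {μ : Measure X} {f : X → Set A} (hf : ∀ a, NullMeasurableSet {x | a ∈ f x} μ) :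
    AEMeasurable f μ := by
  have : AEMeasurable (fun x a => a ∈ f x) μ := by
    refine aemeasurable_pi_lambda _ fun a => ?_
    have := hf a
    refine NullMeasurable.aemeasurable fun t _ => ?_
    -- There are four sets of truth values; the preimages are everything, the event, its complement
    -- and the empty set.
    by_cases hT : True ∈ t <;> by_cases hF : False ∈ t
    · convert! MeasurableSet.univ.nullMeasurableSet (μ := μ)
      ext x
      by_cases hx : a ∈ f x <;> simp [hx, hT, hF]
    · convert! this
      ext x
      by_cases hx : a ∈ f x <;> simp [hx, hT, hF]
    · convert! this.compl
      ext x
      by_cases hx : a ∈ f x <;> simp [hx, hT, hF]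
    · convert! MeasurableSet.empty.nullMeasurableSet (μ := μ)
      ext x
      by_cases hx : a ∈ f x <;> simp [hx, hT, hF]
  exact this

end MeasureTheory

/-! ### The basic distribution and its extension -/

namespace DistDB

variable {S : Vocabulary} (D : DistDB S) (I : S.Interpretation)

instance standardBorelSpace_sampleSpace (ν : D.V) : StandardBorelSpace (D.sampleSpace I ν) :=
  (I.measurableSet_sampleSpace _ _).standardBorel

instance standardBorelSpace_assignment : StandardBorelSpace (D.Assignment I) :=
  inferInstanceAs (StandardBorelSpace ((ν : D.V) → D.sampleSpace I ν))

theorem aemeasurable_ccd {PV : Measure (D.Assignment I)} (hPV : D.IsJointLaw I PV) :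
    AEMeasurable (D.ccd I) PV :=
  aemeasurable_set_of_nullMeasurableSet fun κ => κ.2.2 PV hPV

end DistDB

namespace DFProgram

variable {S : Vocabulary} {I : S.Interpretation} {P : DFProgram I}
  {PV : Measure (P.db.Assignment I)}

theorem isBasicDistribution_map (P : DFProgram I) {PV : Measure (P.db.Assignment I)}
    (hPV : P.db.IsJointLaw I PV) :
    P.IsBasicDistribution PV (PV.map (P.db.ccd I)) where
  isProbabilityMeasure :=
    have := hPV.isProbabilityMeasure
    Measure.isProbabilityMeasure_map (P.db.aemeasurable_ccd I hPV)
  marginal s b :=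
    Measure.map_apply_of_aemeasurable (P.db.aemeasurable_ccd I hPV) (measurableSet_truthValues s b)

theorem IsBasicDistribution.eq {PF PF' : Measure (Set (P.db.comparisons I))}
    (h : P.IsBasicDistribution PV PF) (h' : P.IsBasicDistribution PV PF') : PF = PF' :=
  have := h.isProbabilityMeasure
  Measure.ext_of_truthValues fun s b => (h.marginal s b).trans (h'.marginal s b).symm

theorem IsSatoExtension.eq {PF : Measure (Set (P.db.comparisons I))}
    {PP PP' : Measure (Set S.GroundAtom)}
    (h : P.IsSatoExtension PF PP) (h' : P.IsSatoExtension PF PP') : PP = PP' :=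
  have := h.isProbabilityMeasure
  Measure.ext_of_truthValues fun s b => (h.marginal s b).trans (h'.marginal s b).symm

theorem measurable_logicProgram (P : DFProgram I) : Measurable P.logicProgram := by
  refine measurable_set_iff.2 fun c => ?_
  have : (fun J => c ∈ P.logicProgram J) = fun J =>
      (∃ κ : P.db.comparisons I, κ ∈ J ∧ c = ⟨κ, []⟩) ∨ c ∈ Vocabulary.grounding P.rules := rfl
  rw [this]
  exact (Measurable.exists fun κ => (measurable_set_mem κ).and measurable_const).or
    measurable_const

/-- For a valid program, the basic distribution has an extension to Herbrand interpretations. -/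
theorem isSatoExtension_map (P : DFProgram I) {PV : Measure (P.db.Assignment I)}
    (hP : P.Valid) (hPV : P.db.IsJointLaw I PV) :
    P.IsSatoExtension (PV.map (P.db.ccd I)) ((PV.map (P.db.ccd I)).map P.wfm) := by
  have hprob := hPV.isProbabilityMeasure
  have hccd := P.db.aemeasurable_ccd I hPV
  have hPF := (P.isBasicDistribution_map hPV).isProbabilityMeasure
  -- The range of `ccd` need not be measurable; `K` replaces it, and validity applies on all of `K`.
  obtain ⟨K, hKr, hKm, hK0⟩ := exists_measurableSet_subset_range hccd
  set PF := PV.map (P.db.ccd I)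
  have hae : ∀ᵐ J ∂PF, J ∈ K := hK0
  have htwo : ∀ J ∈ K, WellFoundedSemantics.IsTwoValued (P.logicProgram J) := fun J hJ => by
    obtain ⟨ω, rfl⟩ := hKr hJ
    exact hP ω
  have hwfm : AEMeasurable P.wfm PF := by
    refine aemeasurable_set_of_nullMeasurableSet fun a => ?_
    refine (WellFoundedSemantics.measurableSet_mem_model P.measurable_logicProgram hKm htwo
      a).nullMeasurableSet.congr ?_
    filter_upwards [hae] with J hJ
    exact propext ⟨fun h => h.2, fun h => ⟨hJ, h⟩⟩
  -- On `K`, being a consistent comparisons database is automatic, so only the condition on the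
  -- model remains.
  have heq : ∀ s b, (P.ccdEvent s b : Set _) =ᵐ[PF]
      P.wfm ⁻¹' {M | ∀ μ ∈ s, (μ ∈ M ↔ b μ)} := fun s b => by
    filter_upwards [hae] with J hJ
    obtain ⟨ω, hω⟩ := hKr hJ
    exact propext ⟨fun h => h.2, fun h => ⟨⟨ω, hω.symm⟩, h⟩⟩
  refine ⟨Measure.isProbabilityMeasure_map hwfm, fun s b => ?_, fun s b => ?_⟩
  · exact (hwfm.nullMeasurable (measurableSet_truthValues s b)).congr (heq s b).symm
  · rw [measure_congr (heq s b)]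
    exact Measure.map_apply_of_aemeasurable hwfm (measurableSet_truthValues s b)

end DFProgram

/-! ### Uniqueness of the joint law -/

namespace DistDB

variable {S : Vocabulary} {D : DistDB S} {I : S.Interpretation}

theorem value_app_congr {ω ω' : D.V → ℝ} {k : ℕ} {f : S.Functor k} {ts : Fin k → S.GroundTerm}
    (h : ∀ μ : D.V, Vocabulary.Appears (μ : S.GroundTerm) (Vocabulary.app f ts) → ω μ = ω' μ)
    (hts : ∀ i, D.value I ω (ts i) = D.value I ω' (ts i)) :
    D.value I ω (Vocabulary.app f ts) = D.value I ω' (Vocabulary.app f ts) := by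
  rw [value_app, value_app]
  split_ifs with hf
  · rw [h ⟨_, hf⟩ .refl]
  · simp only [hts]

theorem value_congr {ω ω' : D.V → ℝ} (t : S.GroundTerm)
    (h : ∀ μ : D.V, Vocabulary.Appears (μ : S.GroundTerm) t → ω μ = ω' μ) :
    D.value I ω t = D.value I ω' t := by
  induction t with
  | var e => exact e.elim
  | func f ts ih => exact value_app_congr h fun i => ih i fun μ hμ => h μ (.arg f ts i hμ)

theorem condLaw_congr {ω ω' : D.V → ℝ} {ν : D.V} (h : ∀ μ, D.Parent μ ν → ω μ = ω' μ) :
    D.condLaw I ω ν = D.condLaw I ω' ν := by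
  have : D.dist? I ω ν = D.dist? I ω' ν := by
    unfold dist?
    congr 1
    exact funext fun i => value_congr _ fun μ hμ => h μ (.arg _ _ i hμ)
  simp only [condLaw, this]

/-- The number of ancestors of a random variable. -/
def rank (D : DistDB S) (ν : D.V) : ℕ := {μ | D.Ancestor μ ν}.ncard

namespace IsWellDefined

/-- Ancestors of `μ` are ancestors of `ν`, and `μ` itself is one of `ν` but, by acyclicity, not of
`μ`. -/
theorem rank_lt (hD : D.IsWellDefined I) {μ ν : D.V} (h : D.Ancestor μ ν) :
    D.rank μ < D.rank ν :=
  Set.ncard_lt_ncard ⟨fun _ hl => Relation.TransGen.trans hl h, fun hsub => hD.acyclic μ (hsub h)⟩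
    (hD.finite_ancestors ν)

theorem wellFounded_parent (hD : D.IsWellDefined I) : WellFounded D.Parent :=
  Subrelation.wf (fun h => hD.rank_lt (.single h)) (InvImage.wf D.rank wellFounded_lt)

theorem exists_condLaw_eq (hD : D.IsWellDefined I) {ν : D.V} {ω : D.V → ℝ}
    (hω : D.ParentsSampled I ν ω) : ∃ Q : ProbabilityMeasure ℝ,
      D.condLaw I ω ν = Q ∧ (Q : Measure ℝ) (D.sampleSpace I ν) = 1 := by
  obtain ⟨Q, hQ, h1⟩ := hD.dist_defined ν ω hω
  exact ⟨Q, by simp only [condLaw, hQ], h1⟩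

-- Once the parents can be given values, a distribution of mass 1 lives on the sample space. The
-- samplers below need a nonempty target.
open Classical in
theorem nonempty_sampleSpace (hD : D.IsWellDefined I) (ν : D.V) :
    (D.sampleSpace I ν).Nonempty := by
  induction ν using hD.wellFounded_parent.induction with
  | _ ν ih =>
    obtain ⟨Q, -, h1⟩ := hD.exists_condLaw_eq (ν := ν)
      (ω := fun μ => if h : (D.sampleSpace I μ).Nonempty then h.some else 0) fun μ hμ => by
        simp only [ih μ hμ, dif_pos]
        exact (ih μ hμ).some_mem
    refine nonempty_of_measure_ne_zero (μ := (Q : Measure ℝ)) ?_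
    simp [h1]

end IsWellDefined

theorem measurableSet_sampleSpace (ν : D.V) : MeasurableSet (D.sampleSpace I ν) :=
  I.measurableSet_sampleSpace _ _

/-- The values of random variables for which the parents of `ν` belong to their sample spaces. -/
abbrev ParentValues (D : DistDB S) (I : S.Interpretation) (ν : D.V) : Type :=
  {ω : D.V → ℝ // D.ParentsSampled I ν ω}

open Classical in
/-- Values of the parents of `ν`, extended by zero to all other random variables. -/
def parentValues (ν : D.V) (x : ∀ μ, D.Parent μ ν → D.sampleSpace I μ) : D.ParentValues I ν :=
  ⟨fun μ => if h : D.Parent μ ν then (x μ h : ℝ) else 0, fun μ hμ => by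
    simp only [hμ, dif_pos]
    exact (x μ hμ).2⟩

/-- Factoring through the parents' values is what makes the conditional law measurable for any
σ-algebra that contains the parents' coordinates. -/
theorem condLaw_val (ω : D.Assignment I) (ν : D.V) :
    D.condLaw I ω.val ν = D.condLaw I (parentValues ν fun μ _ => ω μ).1 ν :=
  condLaw_congr fun μ hμ => by simp only [parentValues, hμ, dif_pos, Assignment.val]

theorem measurable_parentValues {Ω : Type*} [MeasurableSpace Ω] {ν : D.V}
    {X : ∀ μ, D.Parent μ ν → Ω → D.sampleSpace I μ} (hX : ∀ μ h, Measurable (X μ h)) :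
    Measurable fun u => parentValues ν fun μ h => X μ h u := by
  refine Measurable.subtype_mk (measurable_pi_lambda _ fun μ => ?_)
  by_cases h : D.Parent μ ν
  · simp only [h, dif_pos]
    exact measurable_subtype_coe.comp (hX μ h)
  · simp only [h, dif_neg, not_false_eq_true, measurable_const]

/-- The σ-algebra generated by the random variables in `A`. -/
@[reducible] def coordSpace (D : DistDB S) (I : S.Interpretation) (A : Set D.V) :
    MeasurableSpace (D.Assignment I) :=
  ⨆ μ ∈ A, MeasurableSpace.comap (fun ω : D.Assignment I => ω μ) inferInstance

theorem comap_le_coordSpace {A : Set D.V} {μ : D.V} (hμ : μ ∈ A) :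
    MeasurableSpace.comap (fun ω : D.Assignment I => ω μ) inferInstance ≤ D.coordSpace I A :=
  le_iSup₂_of_le μ hμ le_rfl

theorem coordSpace_mono {A B : Set D.V} (h : A ⊆ B) : D.coordSpace I A ≤ D.coordSpace I B :=
  biSup_mono h

theorem coordSpace_le (A : Set D.V) : D.coordSpace I A ≤ MeasurableSpace.pi :=
  iSup₂_le fun μ _ => (measurable_pi_apply μ).comap_le

theorem coordSpace_le_nonDescendants {A : Set D.V} {ν : D.V}
    (h : ∀ μ ∈ A, μ ≠ ν ∧ ¬ D.Ancestor ν μ) : D.coordSpace I A ≤ D.nonDescendants I ν :=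
  iSup₂_le fun μ hμ => le_iSup₂_of_le μ (h μ hμ) le_rfl

theorem IsWellDefined.measurable_condLaw (hD : D.IsWellDefined I) {ν : D.V} {A : Set D.V}
    (hA : ∀ μ, D.Parent μ ν → μ ∈ A) {B : Set ℝ} (hB : MeasurableSet B) :
    Measurable[D.coordSpace I A] fun ω : D.Assignment I => D.condLaw I ω.val ν B := by
  simp only [condLaw_val]
  have h := @measurable_parentValues S D I _ (D.coordSpace I A) ν
    (fun μ _ ω => ω μ) fun μ hμ => measurable_iff_comap_le.2 (comap_le_coordSpace (hA μ hμ))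
  exact ((Measure.measurable_coe hB).comp (hD.measurable_dist ν)).comp h

namespace IsJointLaw

variable {PV PV' : Measure (D.Assignment I)}

/-- The events `E ∩ {ω | ω ν ∈ B}`, with `E` depending on `A`, form a generating π-system. Their
probability is the integral over `E` of a conditional law that depends only on `A`. -/
theorem measure_eq_measure_insert (hD : D.IsWellDefined I) (h : D.IsJointLaw I PV)
    (h' : D.IsJointLaw I PV') {A : Set D.V} {ν : D.V} (hpar : ∀ μ, D.Parent μ ν → μ ∈ A)
    (hnd : ∀ μ ∈ A, μ ≠ ν ∧ ¬ D.Ancestor ν μ)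
    (heq : ∀ E, MeasurableSet[D.coordSpace I A] E → PV E = PV' E) :
    ∀ E, MeasurableSet[D.coordSpace I (insert ν A)] E → PV E = PV' E := by
  have := h.isProbabilityMeasure
  have := h'.isProbabilityMeasure
  let C : Set (Set (D.Assignment I)) := {F | ∃ E, MeasurableSet[D.coordSpace I A] E ∧
    ∃ B : Set (D.sampleSpace I ν), MeasurableSet B ∧ F = E ∩ {ω | ω ν ∈ B}}
  have hgen : D.coordSpace I (insert ν A) = MeasurableSpace.generateFrom C := by
    refine le_antisymm (iSup₂_le fun μ hμ => ?_) (MeasurableSpace.generateFrom_le ?_)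
    · rintro _ ⟨B, hB, rfl⟩
      refine MeasurableSpace.measurableSet_generateFrom ?_
      rcases hμ with rfl | hμ
      · exact ⟨Set.univ, MeasurableSet.univ, B, hB, (Set.univ_inter _).symm⟩
      · exact ⟨_, comap_le_coordSpace hμ _ ⟨B, hB, rfl⟩, Set.univ, MeasurableSet.univ, by simp⟩
    · rintro _ ⟨E, hE, B, hB, rfl⟩
      exact (coordSpace_mono (Set.subset_insert ν A) _ hE).inter
        (comap_le_coordSpace (Set.mem_insert ν A) _ ⟨B, hB, rfl⟩)
  have hpi : IsPiSystem C := by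
    rintro _ ⟨E, hE, B, hB, rfl⟩ _ ⟨E', hE', B', hB', rfl⟩ -
    exact ⟨E ∩ E', hE.inter hE', B ∩ B', hB.inter hB', by ext; simp; tauto⟩
  have htrim : PV.trim (coordSpace_le A) = PV'.trim (coordSpace_le A) := by
    refine @Measure.ext _ (D.coordSpace I A) _ _ fun E hE => ?_
    rw [trim_measurableSet_eq _ hE, trim_measurableSet_eq _ hE, heq E hE]
  suffices PV.trim (coordSpace_le (insert ν A)) = PV'.trim (coordSpace_le (insert ν A)) by
    intro E hE
    rw [← trim_measurableSet_eq (coordSpace_le (insert ν A)) hE, this, trim_measurableSet_eq _ hE]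
  refine ext_of_generate_finite C hgen hpi ?_ ?_
  · rintro F ⟨E, hE, B, hB, rfl⟩
    have hFm : MeasurableSet[D.coordSpace I (insert ν A)] (E ∩ {ω | ω ν ∈ B}) := by
      rw [hgen]
      exact MeasurableSpace.measurableSet_generateFrom ⟨E, hE, B, hB, rfl⟩
    have hBm : MeasurableSet (Subtype.val '' B : Set ℝ) :=
      (measurableSet_sampleSpace ν).subtype_image hB
    have hB_eq : {ω : D.Assignment I | ω ν ∈ B} = {ω | ω.val ν ∈ Subtype.val '' B} := by
      ext ω
      exact (Subtype.val_injective.mem_set_image (s := B)).symm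
    -- The integrand and `E` are measurable for the coordinates in `A`, so the integral sees only
    -- the restriction of `Q` to that σ-algebra.
    have hint : ∀ Q : Measure (D.Assignment I), ∫⁻ ω in E, D.condLaw I ω.val ν
        (Subtype.val '' B) ∂Q = ∫⁻ ω in E, D.condLaw I ω.val ν (Subtype.val '' B)
          ∂(Q.trim (coordSpace_le A)) := fun Q => by
      rw [restrict_trim _ _ hE, lintegral_trim _ (hD.measurable_condLaw hpar hBm)]
    rw [trim_measurableSet_eq _ hFm, trim_measurableSet_eq _ hFm, hB_eq,
      h.law ν E _ (coordSpace_le_nonDescendants hnd _ hE) hBm,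
      h'.law ν E _ (coordSpace_le_nonDescendants hnd _ hE) hBm, hint, hint, htrim]
  · rw [trim_measurableSet_eq _ MeasurableSet.univ, trim_measurableSet_eq _ MeasurableSet.univ,
      measure_univ, measure_univ]

theorem measure_eq_measure_of_closed (hD : D.IsWellDefined I) (h : D.IsJointLaw I PV)
    (h' : D.IsJointLaw I PV') (A : Finset D.V)
    (hA : ∀ ν ∈ A, ∀ μ, D.Parent μ ν → μ ∈ A) :
    ∀ E, MeasurableSet[D.coordSpace I (A : Set D.V)] E → PV E = PV' E := by
  classical
  have := h.isProbabilityMeasure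
  have := h'.isProbabilityMeasure
  induction A using Finset.strongInduction with
  | _ A ih =>
    rcases A.eq_empty_or_nonempty with rfl | hne
    · intro E hE
      have hE' : MeasurableSet[⊥] E :=
        (iSup₂_le fun μ hμ => absurd hμ (Finset.notMem_empty μ) :
          D.coordSpace I ((∅ : Finset D.V) : Set D.V) ≤ ⊥) _ hE
      rcases MeasurableSpace.measurableSet_bot_iff.1 hE' with rfl | rfl <;> simp
    -- A variable of maximal rank has no descendant in `A`, so the rest is still parent-closed and
    -- consists of non-descendants.
    · obtain ⟨ν, hν, hmax⟩ := A.exists_max_image D.rank hne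
      have hnd : ∀ μ ∈ A, ¬ D.Ancestor ν μ := fun μ hμ hanc =>
        absurd (hD.rank_lt hanc) (not_lt.2 (hmax μ hμ))
      have key := measure_eq_measure_insert hD h h' (A := (A.erase ν : Finset D.V)) (ν := ν)
        (fun μ hμ => Finset.mem_coe.2 (Finset.mem_erase.2
          ⟨fun he => hD.acyclic ν (.single (he ▸ hμ)), hA ν hν μ hμ⟩))
        (fun μ hμ => ⟨(Finset.mem_erase.1 hμ).1, hnd μ (Finset.mem_erase.1 hμ).2⟩)
        (ih _ (Finset.erase_ssubset hν) fun l hl μ hμ => Finset.mem_erase.2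
          ⟨fun he => hnd l (Finset.mem_erase.1 hl).2 (.single (he ▸ hμ)),
            hA l (Finset.mem_erase.1 hl).2 μ hμ⟩)
      have hins : insert ν ((A.erase ν : Finset D.V) : Set D.V) = A := by
        rw [← Finset.coe_insert, Finset.insert_erase hν]
      rwa [hins] at key

theorem eq (hD : D.IsWellDefined I) (h : D.IsJointLaw I PV) (h' : D.IsJointLaw I PV') :
    PV = PV' := by
  classical
  have := h.isProbabilityMeasure
  have := h'.isProbabilityMeasure
  refine ext_of_generate_finite {E | ∃ A : Finset D.V, (∀ ν ∈ A, ∀ μ, D.Parent μ ν → μ ∈ A) ∧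
    MeasurableSet[D.coordSpace I (A : Set D.V)] E} ?_ ?_ ?_ ?_
  · refine le_antisymm (iSup_le fun ν => ?_) (MeasurableSpace.generateFrom_le ?_)
    · rintro _ ⟨B, hB, rfl⟩
      refine MeasurableSpace.measurableSet_generateFrom
        -- A variable together with its ancestors is finite and parent-closed.
        ⟨insert ν (hD.finite_ancestors ν).toFinset, fun l hl μ hμ => ?_, ?_⟩
      · refine Finset.mem_insert_of_mem ((hD.finite_ancestors ν).mem_toFinset.2 ?_)
        rcases Finset.mem_insert.1 hl with rfl | hl
        · exact .single hμ
        · exact .head hμ ((hD.finite_ancestors ν).mem_toFinset.1 hl)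
      · exact comap_le_coordSpace (Finset.mem_coe.2 (Finset.mem_insert_self _ _)) _ ⟨B, hB, rfl⟩
    · rintro E ⟨A, -, hE⟩
      exact coordSpace_le _ _ hE
  · rintro E ⟨A, hA, hE⟩ E' ⟨A', hA', hE'⟩ -
    refine ⟨A ∪ A', fun ν hν μ hμ => ?_, MeasurableSet.inter
      (coordSpace_mono (by simp) _ hE) (coordSpace_mono (by simp) _ hE')⟩
    rcases Finset.mem_union.1 hν with hν | hν
    · exact Finset.mem_union_left _ (hA ν hν μ hμ)
    · exact Finset.mem_union_right _ (hA' ν hν μ hμ)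
  · rintro E ⟨A, hA, hE⟩
    exact measure_eq_measure_of_closed hD h h' A hA E hE
  · rw [measure_univ, measure_univ]

end IsJointLaw

end DistDB

/-! ### Existence of the joint law by sampling from noise -/

namespace DistDB

open ProbabilityTheory

variable {S : Vocabulary} {D : DistDB S} {I : S.Interpretation}

/-- The σ-algebra generated by the noise of the random variables in `A`. -/
@[reducible] def noiseSpace (D : DistDB S) (A : Set D.V) :
    MeasurableSpace (D.V → unitInterval) :=
  ⨆ μ ∈ A, MeasurableSpace.comap (fun u : D.V → unitInterval => u μ) inferInstance

theorem measurable_noise {A : Set D.V} {μ : D.V} (hμ : μ ∈ A) :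
    Measurable[D.noiseSpace A] fun u : D.V → unitInterval => u μ :=
  measurable_iff_comap_le.2 (le_iSup₂_of_le μ hμ le_rfl)

theorem noiseSpace_le (A : Set D.V) : D.noiseSpace A ≤ MeasurableSpace.pi :=
  iSup₂_le fun μ _ => (measurable_pi_apply μ).comap_le

/-- The joint law of independent uniformly distributed noise values. -/
def noiseLaw (D : DistDB S) : Measure (D.V → unitInterval) :=
  Measure.infinitePi fun _ => volume

instance isProbabilityMeasure_noiseLaw (D : DistDB S) :
    IsProbabilityMeasure D.noiseLaw :=
  inferInstanceAs (IsProbabilityMeasure (Measure.infinitePi _))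

theorem indep_noise (ν : D.V) :
    Indep (D.noiseSpace {ν}ᶜ)
      (MeasurableSpace.comap (fun u : D.V → unitInterval => u ν) inferInstance) D.noiseLaw := by
  have h : iIndepFun (fun (μ : D.V) (u : D.V → unitInterval) => u μ) D.noiseLaw :=
    iIndepFun_infinitePi (X := fun _ x => x) fun _ => measurable_id
  have := indep_iSup_of_disjoint (fun μ => (measurable_pi_apply μ).comap_le) h.iIndep
    (disjoint_compl_left (a := ({ν} : Set D.V)))
  simpa only [Set.mem_singleton_iff, iSup_iSup_eq_left] using this

namespace IsWellDefined

/-- The distribution of `ν` on its sample space, given values of its parents. -/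
def kernel (hD : D.IsWellDefined I) (ν : D.V) :
    Kernel (D.ParentValues I ν) (D.sampleSpace I ν) where
  toFun y := (D.condLaw I y.1 ν).comap Subtype.val
  measurable' := by
    refine Measure.measurable_of_measurable_coe _ fun B hB => ?_
    simp only [(MeasurableEmbedding.subtype_coe (measurableSet_sampleSpace ν)).comap_apply]
    exact (Measure.measurable_coe ((measurableSet_sampleSpace ν).subtype_image hB)).comp
      (hD.measurable_dist ν)

/-- The conditional law gives its sample space full mass, so nothing is lost by restricting to it.
-/
theorem kernel_apply_preimage (hD : D.IsWellDefined I) {ν : D.V} (y : D.ParentValues I ν)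
    (B : Set ℝ) : hD.kernel ν y (Subtype.val ⁻¹' B) = D.condLaw I y.1 ν B := by
  change (D.condLaw I y.1 ν).comap Subtype.val _ = _
  rw [(MeasurableEmbedding.subtype_coe (measurableSet_sampleSpace ν)).comap_apply,
    Subtype.image_preimage_coe, Set.inter_comm]
  obtain ⟨Q, hQ, h1⟩ := hD.exists_condLaw_eq y.2
  rw [hQ]
  exact measure_inter_conull ((prob_compl_eq_zero_iff (measurableSet_sampleSpace ν)).2 h1)

instance isMarkovKernel_kernel (hD : D.IsWellDefined I) (ν : D.V) :
    IsMarkovKernel (hD.kernel ν) where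
  isProbabilityMeasure y := ⟨by
    obtain ⟨Q, hQ, -⟩ := hD.exists_condLaw_eq y.2
    rw [← Set.preimage_univ (f := Subtype.val), kernel_apply_preimage, hQ, measure_univ]⟩

/-- Randomization: a Markov kernel into a nonempty standard Borel space is simulated by one uniform
variable, jointly measurably in the parameter. -/
theorem exists_sampler (hD : D.IsWellDefined I) (ν : D.V) :
    ∃ f : D.ParentValues I ν → unitInterval → D.sampleSpace I ν,
      Measurable (Function.uncurry f) ∧ ∀ y, volume.map (f y) = hD.kernel ν y :=
  have := (hD.nonempty_sampleSpace ν).to_subtype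
  (hD.kernel ν).exists_measurable_map_eq_unitInterval

/-- A function that turns uniformly distributed noise into samples of `ν`, given values of the
parents of `ν`. -/
def sampler (hD : D.IsWellDefined I) (ν : D.V) :
    D.ParentValues I ν → unitInterval → D.sampleSpace I ν :=
  (hD.exists_sampler ν).choose

theorem measurable_sampler (hD : D.IsWellDefined I) (ν : D.V) :
    Measurable (Function.uncurry (hD.sampler ν)) :=
  (hD.exists_sampler ν).choose_spec.1

theorem map_sampler (hD : D.IsWellDefined I) {ν : D.V} (y : D.ParentValues I ν) :
    volume.map (hD.sampler ν y) = hD.kernel ν y :=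
  (hD.exists_sampler ν).choose_spec.2 y

/-- The value assignment computed from a noise value for each random variable, following the
parent relation. -/
def sample (hD : D.IsWellDefined I) (u : D.V → unitInterval) : D.Assignment I :=
  hD.wellFounded_parent.fix fun ν x => hD.sampler ν (parentValues ν x) (u ν)

theorem sample_apply (hD : D.IsWellDefined I) (u : D.V → unitInterval) (ν : D.V) :
    hD.sample u ν = hD.sampler ν (parentValues ν fun μ _ => hD.sample u μ) (u ν) :=
  hD.wellFounded_parent.fix_eq _ ν

/-- The value of `ν` reads only the noise of `ν` and of its ancestors, all of which lie in `A`. -/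
theorem measurable_sample_of_closed (hD : D.IsWellDefined I) {A : Set D.V}
    (hA : ∀ ν ∈ A, ∀ μ, D.Parent μ ν → μ ∈ A) {ν : D.V} (hν : ν ∈ A) :
    Measurable[D.noiseSpace A] fun u => hD.sample u ν := by
  induction ν using hD.wellFounded_parent.induction with
  | _ ν ih =>
    simp only [hD.sample_apply _ ν]
    have h := @measurable_parentValues S D I _ (D.noiseSpace A) ν
      (fun μ _ u => hD.sample u μ) fun μ hμ => ih μ hμ (hA ν hν μ hμ)
    exact (hD.measurable_sampler ν).comp (h.prodMk (measurable_noise hν))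

theorem measurable_sample (hD : D.IsWellDefined I) : Measurable hD.sample :=
  measurable_pi_lambda _ fun ν => (hD.measurable_sample_of_closed (A := Set.univ)
    (fun _ _ _ _ => trivial) (Set.mem_univ ν)).mono (noiseSpace_le _) le_rfl

/-- The non-descendants of `ν` form a parent-closed set without `ν`, so their values never read the
noise of `ν`. -/
theorem measurable_sample_nonDescendants (hD : D.IsWellDefined I) (ν : D.V) :
    Measurable[D.noiseSpace {ν}ᶜ, D.nonDescendants I ν] hD.sample := by
  refine measurable_iff_le_map.2 (iSup₂_le fun μ hμ => ?_)
  rintro _ ⟨B, hB, rfl⟩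
  have hA : ∀ l ∈ {l | l ≠ ν ∧ ¬ D.Ancestor ν l}, ∀ κ, D.Parent κ l →
      κ ∈ {l | l ≠ ν ∧ ¬ D.Ancestor ν l} := fun l hl κ hκ =>
    ⟨fun he => hl.2 (.single (he ▸ hκ)), fun hanc => hl.2 (.tail hanc hκ)⟩
  exact (hD.measurable_sample_of_closed hA hμ).mono (biSup_mono fun l hl => hl.1) le_rfl hB

theorem isJointLaw_map_sample (hD : D.IsWellDefined I) :
    D.IsJointLaw I (D.noiseLaw.map hD.sample) where
  isProbabilityMeasure := Measure.isProbabilityMeasure_map hD.measurable_sample.aemeasurable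
  law ν E B hE hB := by
    have hnd : D.nonDescendants I ν ≤ MeasurableSpace.pi :=
      iSup₂_le fun μ _ => (measurable_pi_apply μ).comap_le
    have hEm : MeasurableSet E := hnd _ hE
    have hBν : MeasurableSet {ω : D.Assignment I | ω.val ν ∈ B} :=
      (measurable_subtype_coe.comp (measurable_pi_apply ν)) hB
    have hcond : Measurable fun ω : D.Assignment I => D.condLaw I ω.val ν B :=
      (hD.measurable_condLaw (A := Set.univ) (fun _ _ => trivial) hB).mono (coordSpace_le _) le_rfl
    -- `Z` records the parents' values and whether `E` occurs. It ignores the noise of `ν`, hence is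
    -- independent of it, and Fubini applies to the pair.
    let Z : (D.V → unitInterval) → D.ParentValues I ν × Prop := fun u =>
      (parentValues ν fun μ _ => hD.sample u μ, hD.sample u ∈ E)
    have hZ : Measurable[D.noiseSpace {ν}ᶜ] Z := by
      refine Measurable.prodMk (@measurable_parentValues S D I _ (D.noiseSpace {ν}ᶜ) ν
        (fun μ _ u => hD.sample u μ) fun μ hμ => ?_) ?_
      · have hμν : μ ≠ ν ∧ ¬ D.Ancestor ν μ :=
          ⟨fun he => hD.acyclic ν (.single (he ▸ hμ)),
            fun hanc => hD.acyclic ν (.tail hanc hμ)⟩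
        have hm : Measurable[D.nonDescendants I ν] fun ω : D.Assignment I => ω μ :=
          measurable_iff_comap_le.2 (le_iSup₂_of_le μ hμν le_rfl)
        exact hm.comp (hD.measurable_sample_nonDescendants ν)
      · exact (@measurableSet_setOfPred _ (D.noiseSpace {ν}ᶜ) _).1
          (hD.measurable_sample_nonDescendants ν hE)
    have hZ' : Measurable Z := hZ.mono (noiseSpace_le _) le_rfl
    have hU : Measurable fun u : D.V → unitInterval => u ν := measurable_pi_apply ν
    have hind : IndepFun Z (fun u => u ν) D.noiseLaw :=
      indep_of_indep_of_le_left (indep_noise ν) hZ.comap_le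
    have hmap := hind.map_prod_eq_prod_map_map hZ'.aemeasurable hU.aemeasurable
    have hUmap : D.noiseLaw.map (fun u => u ν) = volume := Measure.infinitePi_map_eval _ ν
    rw [hUmap] at hmap
    let T : Set ((D.ParentValues I ν × Prop) × unitInterval) :=
      {p | p.1.2 ∧ (hD.sampler ν p.1.1 p.2 : ℝ) ∈ B}
    have hT : MeasurableSet T := by
      refine MeasurableSet.inter (measurableSet_setOfPred.2 (measurable_snd.comp measurable_fst)) ?_
      exact (measurable_subtype_coe.comp ((hD.measurable_sampler ν).comp
        ((measurable_fst.comp measurable_fst).prodMk measurable_snd))) hB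
    have hpre : hD.sample ⁻¹' (E ∩ {ω | ω.val ν ∈ B}) = (fun u => (Z u, u ν)) ⁻¹' T := by
      ext u
      simp only [Set.mem_preimage, Set.mem_inter_iff, Set.mem_ofPred_eq, Assignment.val,
        hD.sample_apply u ν, Z, T]
    -- For fixed `Z`, fresh uniform noise passes through the sampler: the section has the
    -- conditional probability of `B` if `E` occurs, and measure 0 otherwise.
    have hsec : ∀ u, volume (Prod.mk (Z u) ⁻¹' T) =
        (hD.sample ⁻¹' E).indicator (fun u => D.condLaw I (hD.sample u).val ν B) u := by
      intro u
      by_cases hu : u ∈ hD.sample ⁻¹' E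
      · have hu' : hD.sample u ∈ E := hu
        rw [Set.indicator_of_mem hu, condLaw_val, ← hD.kernel_apply_preimage, ← hD.map_sampler,
          Measure.map_apply ((hD.measurable_sampler ν).of_uncurry_left)
            (measurable_subtype_coe hB)]
        congr 1
        ext t
        simp [Z, T, hu']
      · have hu' : hD.sample u ∉ E := hu
        rw [Set.indicator_of_notMem hu]
        convert! measure_empty (μ := (volume : Measure unitInterval))
        ext t
        simp [Z, T, hu']
    rw [Measure.map_apply hD.measurable_sample (hEm.inter hBν), hpre,
      ← Measure.map_apply (hZ'.prodMk hU) hT, hmap, Measure.prod_apply hT,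
      lintegral_map (measurable_measure_prodMk_left hT) hZ']
    simp only [hsec]
    rw [lintegral_indicator (hD.measurable_sample hEm),
      setLIntegral_map hEm hcond hD.measurable_sample]

end IsWellDefined

end DistDB

end

theorem mainTheorem1 {S : Vocabulary} {I : S.Interpretation} (P : DFProgram I) (hP : P.Valid) :
    ∃ (PV : Measure (P.db.Assignment I)) (PF : Measure (Set (P.db.comparisons I)))
      (PP : Measure (Set S.GroundAtom)),
      (P.db.IsJointLaw I PV ∧ ∀ PV', P.db.IsJointLaw I PV' → PV' = PV) ∧
      (P.IsBasicDistribution PV PF ∧ ∀ PF', P.IsBasicDistribution PV PF' → PF' = PF) ∧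
      (P.IsSatoExtension PF PP ∧ ∀ PP', P.IsSatoExtension PF PP' → PP' = PP) :=
  have hPV := P.wellDefined.isJointLaw_map_sample
  have hPF := P.isBasicDistribution_map hPV
  have hPP := P.isSatoExtension_map hP hPV
  ⟨_, _, _, ⟨hPV, fun _ h => h.eq P.wellDefined hPV⟩, ⟨hPF, fun _ h => h.eq hPF⟩,
    hPP, fun _ h => h.eq hPP⟩
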